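/- Let $\mathcal H$ and $\mathcal K$ be finite-dimensional complex Hilbert spaces with $N=\dim\mathcal H\ge 1$, and let $U$ be a unitary operator on $\mathcal H\otimes\mathcal K$. For an operator $X$ on $\mathcal K$ put $$\mathcal L(X)=\operatorname{Tr}_{\mathcal H}\!\left[U\left(\tfrac1N I_{\mathcal H}\otimes X\right)U^*\right],$$ where $\operatorname{Tr}_{\mathcal H}$ denotes the partial trace over $\mathcal H$, and for a density matrix $\omega$ on $\mathcal K$ (a positive semidefinite operator of trace one) let $S(\omega)=-\operatorname{Tr}[\omega\log\omega]$ be its von Neumann entropy, with the convention $0\log 0=0$. Then for every density matrix $\omega$ on $\mathcal K$, $$S(\omega)\le S(\mathcal L(\omega)),$$ and equality holds if and only if $$U\left(\tfrac1N I_{\mathcal H}\otimes\omega\right)U^*=\tfrac1N I_{\mathcal H}\otimes\mathcal L(\omega).$$ -/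

import Mathlib

open scoped Kronecker ComplexOrder

noncomputable section

/-- A density matrix: a positive semidefinite matrix of trace one. -/
def IsDensityMatrix {κ : Type*} [Fintype κ] (ω : Matrix κ κ ℂ) : Prop :=
  ω.PosSemidef ∧ ω.trace = 1

/-- The partial trace over the first tensor factor, `Tr_H : B(H ⊗ K) → B(K)`, where
`H = ℂ^ι`, `K = ℂ^κ` and `H ⊗ K = ℂ^(ι × κ)`. -/
def partialTraceFst {ι κ : Type*} [Fintype ι] (M : Matrix (ι × κ) (ι × κ) ℂ) : Matrix κ κ ℂ :=
  Matrix.of fun k l => ∑ i, M (i, k) (i, l)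

/-- The operator `(1/N) I_H ⊗ X` on `H ⊗ K`, with `N = dim H`. -/
def maxMixedTensor (ι : Type*) {κ : Type*} [Fintype ι] [DecidableEq ι] (X : Matrix κ κ ℂ) :
    Matrix (ι × κ) (ι × κ) ℂ :=
  ((1 / (Fintype.card ι : ℂ)) • (1 : Matrix ι ι ℂ)) ⊗ₖ X

/-- The map `L(X) = Tr_H [U ((1/N) I_H ⊗ X) U*]` on `B(K)`. -/
def environmentMap {ι κ : Type*} [Fintype ι] [DecidableEq ι] [Fintype κ]
    (U : Matrix (ι × κ) (ι × κ) ℂ) (X : Matrix κ κ ℂ) : Matrix κ κ ℂ :=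
  partialTraceFst (U * maxMixedTensor ι X * U.conjTranspose)

/-- The von Neumann entropy `S(ω) = -Tr [φ(ω)]`, where `φ(x) = x log x` (so `φ(0) = 0`) is applied
to the matrix `ω` by functional calculus. -/
def vonNeumannEntropy {κ : Type*} [Fintype κ] [DecidableEq κ] (ω : Matrix κ κ ℂ) : ℝ :=
  -(Matrix.trace (cfc (fun x : ℝ => x * Real.log x) ω)).re

end

open Matrix Finset

/-! Diagonalise `ω = V diag(p) V*` and `L(ω) = W diag(q) W*`, and view `U` in these bases as the
unitary `T = (1 ⊗ W)* U (1 ⊗ V)`. The diagonal of `L(ω)` in the basis `W` gives `q = B p`, where `B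
l k` is `1/N` times the sum of `|T (i, l) (j, k)|²` over `i` and `j`. Unitarity of `T` makes `B`
doubly stochastic, so Jensen for the strictly concave `-x log x` gives the inequality. Equality in
Jensen forces `p k = q l` wherever `B l k ≠ 0`, that is, wherever the block of `T` at `(l, k)` is
nonzero. With `P = 1 ⊗ diag(p)` and `Q = 1 ⊗ diag(q)` this is `T P = Q T`, or `T P T* = Q`, which is
the stated operator identity read in the basis `1 ⊗ W`. -/

/-- For a doubly stochastic matrix `B` and a strictly concave `f`, passing from `p` to `B p` does
not decrease `∑ f`, and leaves it unchanged only if `B` relates equal values. -/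
theorem StrictConcaveOn.sum_le_sum_of_doublyStochastic {κ : Type*} [Fintype κ] {s : Set ℝ}
    {f : ℝ → ℝ} (hf : StrictConcaveOn ℝ s f) {B : κ → κ → ℝ} (hB : ∀ l k, 0 ≤ B l k)
    (hrow : ∀ l, ∑ k, B l k = 1) (hcol : ∀ k, ∑ l, B l k = 1) {p q : κ → ℝ} (hp : ∀ k, p k ∈ s)
    (hq : ∀ l, q l = ∑ k, B l k * p k) :
    ∑ k, f (p k) ≤ ∑ l, f (q l) ∧
      (∑ k, f (p k) = ∑ l, f (q l) ↔ ∀ l k, B l k ≠ 0 → p k = q l) := by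
  have hsum : ∑ k, f (p k) = ∑ l, ∑ k, B l k • f (p k) := by
    rw [sum_comm]
    simp [← sum_mul, hcol]
  have hle (l : κ) : ∑ k, B l k • f (p k) ≤ f (q l) := by
    rw [hq]
    exact hf.concaveOn.le_map_sum (fun k _ => hB l k) (hrow l) fun k _ => hp k
  have heq (l : κ) : ∑ k, B l k • f (p k) = f (q l) ↔ ∀ k, B l k ≠ 0 → p k = q l := by
    have h := hf.map_sum_eq_iff' (fun k _ => hB l k) (hrow l) (fun k (_ : k ∈ univ) => hp k)
    simp only [mem_univ, true_imp_iff, smul_eq_mul, ← hq] at h ⊢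
    rw [← h, eq_comm]
  rw [hsum]
  refine ⟨sum_le_sum fun l _ => hle l, ?_⟩
  rw [sum_eq_sum_iff_of_le fun l _ => hle l]
  simp only [mem_univ, true_imp_iff, heq]

theorem vonNeumannEntropy_eq_sum_negMulLog {κ : Type*} [Fintype κ] [DecidableEq κ]
    {A : Matrix κ κ ℂ} (hA : A.IsHermitian) :
    vonNeumannEntropy A = ∑ k, Real.negMulLog (hA.eigenvalues k) := by
  rw [vonNeumannEntropy, hA.cfc_eq, Matrix.IsHermitian.cfc, Unitary.conjStarAlgAut_apply,
    Matrix.trace_mul_comm, ← mul_assoc, Unitary.coe_star_mul_self, one_mul]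
  simp [Matrix.trace, Real.negMulLog, -Complex.ofReal_mul]

theorem Matrix.IsHermitian.eq_eigenvectorUnitary_mul {κ : Type*} [Fintype κ] [DecidableEq κ]
    {A : Matrix κ κ ℂ} (hA : A.IsHermitian) :
    A = (hA.eigenvectorUnitary : Matrix κ κ ℂ) * diagonal (fun k => (hA.eigenvalues k : ℂ)) *
      (hA.eigenvectorUnitary : Matrix κ κ ℂ)ᴴ := by
  conv_lhs => rw [hA.spectral_theorem, Unitary.conjStarAlgAut_apply]
  rfl

section PartialTrace

variable {ι κ : Type*} [Fintype ι]

theorem Matrix.IsHermitian.partialTraceFst {M : Matrix (ι × κ) (ι × κ) ℂ} (hM : M.IsHermitian) :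
    (_root_.partialTraceFst M).IsHermitian := by
  ext k l
  simp [_root_.partialTraceFst, hM.apply]

theorem partialTraceFst_smul (c : ℂ) (M : Matrix (ι × κ) (ι × κ) ℂ) :
    partialTraceFst (c • M) = c • partialTraceFst M := by
  ext k l
  simp [partialTraceFst, mul_sum]

variable [DecidableEq ι]

theorem maxMixedTensor_eq_smul (X : Matrix κ κ ℂ) :
    maxMixedTensor ι X = (1 / (Fintype.card ι : ℂ)) • ((1 : Matrix ι ι ℂ) ⊗ₖ X) := by
  rw [maxMixedTensor, smul_kronecker]

theorem Matrix.IsHermitian.maxMixedTensor {X : Matrix κ κ ℂ} (hX : X.IsHermitian) :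
    (_root_.maxMixedTensor ι X).IsHermitian := by
  rw [Matrix.IsHermitian, _root_.maxMixedTensor, conjTranspose_kronecker, hX.eq]
  simp

variable [Fintype κ]

theorem one_kronecker_mul_apply (A : Matrix κ κ ℂ) (M : Matrix (ι × κ) (ι × κ) ℂ) (i : ι) (k : κ)
    (y : ι × κ) : (((1 : Matrix ι ι ℂ) ⊗ₖ A) * M) (i, k) y = ∑ a, A k a * M (i, a) y := by
  simp [Matrix.mul_apply, Fintype.sum_prod_type, Matrix.one_apply, kroneckerMap_apply]

theorem mul_one_kronecker_apply (A : Matrix κ κ ℂ) (M : Matrix (ι × κ) (ι × κ) ℂ) (i : ι) (k : κ)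
    (x : ι × κ) : (M * ((1 : Matrix ι ι ℂ) ⊗ₖ A)) x (i, k) = ∑ a, M x (i, a) * A a k := by
  simp [Matrix.mul_apply, Fintype.sum_prod_type, Matrix.one_apply, kroneckerMap_apply]

/-- Together with its right-handed version, this lets a change of basis on the second factor pass
through the partial trace. -/
theorem partialTraceFst_one_kronecker_mul (A : Matrix κ κ ℂ) (M : Matrix (ι × κ) (ι × κ) ℂ) :
    partialTraceFst (((1 : Matrix ι ι ℂ) ⊗ₖ A) * M) = A * partialTraceFst M := by
  ext k l
  simp only [partialTraceFst, of_apply, one_kronecker_mul_apply]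
  simp only [Matrix.mul_apply, of_apply, mul_sum]
  exact sum_comm

theorem partialTraceFst_mul_one_kronecker (A : Matrix κ κ ℂ) (M : Matrix (ι × κ) (ι × κ) ℂ) :
    partialTraceFst (M * ((1 : Matrix ι ι ℂ) ⊗ₖ A)) = partialTraceFst M * A := by
  ext k l
  simp only [partialTraceFst, of_apply, mul_one_kronecker_apply]
  simp only [Matrix.mul_apply, of_apply, sum_mul]
  exact sum_comm

theorem Matrix.IsHermitian.environmentMap {X : Matrix κ κ ℂ} (hX : X.IsHermitian)
    (U : Matrix (ι × κ) (ι × κ) ℂ) : (_root_.environmentMap U X).IsHermitian :=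
  (isHermitian_mul_mul_conjTranspose U hX.maxMixedTensor).partialTraceFst

theorem one_kronecker_conj_diagonal [DecidableEq κ] (V : Matrix κ κ ℂ) (p : κ → ℂ) :
    (1 : Matrix ι ι ℂ) ⊗ₖ (V * diagonal p * Vᴴ) =
      ((1 : Matrix ι ι ℂ) ⊗ₖ V) * diagonal (fun x : ι × κ => p x.2) *
        ((1 : Matrix ι ι ℂ) ⊗ₖ V)ᴴ := by
  have hd : diagonal (fun x : ι × κ => p x.2) = (1 : Matrix ι ι ℂ) ⊗ₖ diagonal p := by
    rw [← diagonal_one, diagonal_kronecker_diagonal]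
    simp
  rw [hd, conjTranspose_kronecker, conjTranspose_one, ← mul_kronecker_mul, ← mul_kronecker_mul,
    one_mul, one_mul]

end PartialTrace

theorem sum_normSq_row_of_mem_unitaryGroup {n : Type*} [Fintype n] [DecidableEq n]
    {T : Matrix n n ℂ} (hT : T ∈ Matrix.unitaryGroup n ℂ) (x : n) :
    ∑ y, Complex.normSq (T x y) = 1 := by
  have h := congrFun (congrFun (mem_unitaryGroup_iff.1 hT) x) x
  simp only [star_eq_conjTranspose, Matrix.mul_apply, conjTranspose_apply, one_apply_eq,
    RCLike.star_def, Complex.mul_conj] at h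
  exact_mod_cast h

theorem sum_normSq_col_of_mem_unitaryGroup {n : Type*} [Fintype n] [DecidableEq n]
    {T : Matrix n n ℂ} (hT : T ∈ Matrix.unitaryGroup n ℂ) (y : n) :
    ∑ x, Complex.normSq (T x y) = 1 := by
  have h := sum_normSq_row_of_mem_unitaryGroup (Unitary.star_mem hT) y
  simpa [star_eq_conjTranspose] using h

/-- The transition weights on `κ` given by averaging `|T (i, l) (j, k)|²` over `ι`. -/
noncomputable def transitionWeight {ι κ : Type*} [Fintype ι] (T : Matrix (ι × κ) (ι × κ) ℂ)
    (l k : κ) : ℝ :=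
  (1 / (Fintype.card ι : ℝ)) * ∑ i, ∑ j, Complex.normSq (T (i, l) (j, k))

section TransitionWeight

variable {ι κ : Type*} [Fintype ι] {T : Matrix (ι × κ) (ι × κ) ℂ}

theorem transitionWeight_nonneg (l k : κ) : 0 ≤ transitionWeight T l k :=
  mul_nonneg (by positivity)
    (sum_nonneg fun _ _ => sum_nonneg fun _ _ => Complex.normSq_nonneg _)

/-- A sum of nonnegative terms vanishes only termwise; this carries the equality case of Jensen back
to the entries of `T`. -/
theorem transitionWeight_ne_zero_iff [Nonempty ι] (l k : κ) :
    transitionWeight T l k ≠ 0 ↔ ∃ i j, T (i, l) (j, k) ≠ 0 := by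
  rw [← not_iff_not]
  push Not
  rw [transitionWeight, mul_eq_zero_iff_left (by simp),
    sum_eq_zero_iff_of_nonneg fun _ _ => sum_nonneg fun _ _ => Complex.normSq_nonneg _]
  simp [sum_eq_zero_iff_of_nonneg fun _ _ => Complex.normSq_nonneg _]

variable [DecidableEq ι] [Fintype κ] [DecidableEq κ]

theorem partialTraceFst_conj_diagonal_apply_self (T : Matrix (ι × κ) (ι × κ) ℂ) (p : κ → ℝ)
    (l : κ) :
    (1 / (Fintype.card ι : ℂ)) *
        partialTraceFst (T * diagonal (fun x : ι × κ => (p x.2 : ℂ)) * Tᴴ) l l =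
      ((∑ k, transitionWeight T l k * p k : ℝ) : ℂ) := by
  have h (i : ι) : (T * diagonal (fun x : ι × κ => (p x.2 : ℂ)) * Tᴴ) (i, l) (i, l) =
      ∑ k, ∑ j, (Complex.normSq (T (i, l) (j, k)) * p k : ℂ) := by
    rw [Matrix.mul_apply, Fintype.sum_prod_type_right]
    refine sum_congr rfl fun k _ => sum_congr rfl fun j _ => ?_
    rw [mul_diagonal, conjTranspose_apply, RCLike.star_def, mul_right_comm, Complex.mul_conj]
  simp only [partialTraceFst, of_apply, h, transitionWeight]
  push_cast
  rw [sum_comm, mul_sum]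
  simp only [mul_assoc, sum_mul]

variable [Nonempty ι]

/-- For each `i`, summing over `j` and `k` exhausts a row of `T`; the factor `1/N` then averages
over `i`. This reflects that the map is unital, while the column sums reflect that it preserves the
trace. -/
theorem sum_transitionWeight_row (hT : T ∈ Matrix.unitaryGroup (ι × κ) ℂ) (l : κ) :
    ∑ k, transitionWeight T l k = 1 := by
  have h (i : ι) : ∑ k, ∑ j, Complex.normSq (T (i, l) (j, k)) = 1 := by
    rw [← sum_normSq_row_of_mem_unitaryGroup hT (i, l), Fintype.sum_prod_type_right]
  simp only [transitionWeight, ← mul_sum]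
  rw [sum_comm]
  simp [h]

theorem sum_transitionWeight_col (hT : T ∈ Matrix.unitaryGroup (ι × κ) ℂ) (k : κ) :
    ∑ l, transitionWeight T l k = 1 := by
  have h (j : ι) : ∑ l, ∑ i, Complex.normSq (T (i, l) (j, k)) = 1 := by
    rw [← sum_normSq_col_of_mem_unitaryGroup hT (j, k), Fintype.sum_prod_type_right]
  simp only [transitionWeight, ← mul_sum]
  rw [sum_congr rfl fun l _ => sum_comm, sum_comm]
  simp [h]

end TransitionWeight

theorem lemma3p11 {ι κ : Type*} [Fintype ι] [DecidableEq ι] [Nonempty ι]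
    [Fintype κ] [DecidableEq κ]
    (U : Matrix (ι × κ) (ι × κ) ℂ) (hU : U ∈ Matrix.unitaryGroup (ι × κ) ℂ)
    (ω : Matrix κ κ ℂ) (hω : IsDensityMatrix ω) :
    vonNeumannEntropy ω ≤ vonNeumannEntropy (environmentMap U ω) ∧
      (vonNeumannEntropy ω = vonNeumannEntropy (environmentMap U ω) ↔
        U * maxMixedTensor ι ω * U.conjTranspose = maxMixedTensor ι (environmentMap U ω)) := by
  have hA : ω.IsHermitian := hω.1.isHermitian
  have hS : (environmentMap U ω).IsHermitian := hA.environmentMap U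
  rw [vonNeumannEntropy_eq_sum_negMulLog hA, vonNeumannEntropy_eq_sum_negMulLog hS]
  have hV := hA.eigenvectorUnitary.2
  have hW := hS.eigenvectorUnitary.2
  have hωV := hA.eq_eigenvectorUnitary_mul
  have hσW := hS.eq_eigenvectorUnitary_mul
  have hp : ∀ k, hA.eigenvalues k ∈ Set.Ici (0 : ℝ) := hω.1.eigenvalues_nonneg
  -- From here on only unitarity of `V` and `W`, the two decompositions and `p ≥ 0` matter.
  generalize (hA.eigenvectorUnitary : Matrix κ κ ℂ) = V at hV hωV
  generalize (hS.eigenvectorUnitary : Matrix κ κ ℂ) = W at hW hσW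
  generalize hA.eigenvalues = p at hωV hp ⊢
  generalize hS.eigenvalues = q at hσW ⊢
  set V' : Matrix (ι × κ) (ι × κ) ℂ := (1 : Matrix ι ι ℂ) ⊗ₖ V with hV'
  set W' : Matrix (ι × κ) (ι × κ) ℂ := (1 : Matrix ι ι ℂ) ⊗ₖ W with hW'
  set P : Matrix (ι × κ) (ι × κ) ℂ := diagonal fun x => (p x.2 : ℂ) with hP
  set Q : Matrix (ι × κ) (ι × κ) ℂ := diagonal fun x => (q x.2 : ℂ) with hQ
  have hVu : V' ∈ Matrix.unitaryGroup (ι × κ) ℂ := kronecker_mem_unitary (one_mem _) hV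
  have hWu : W' ∈ Matrix.unitaryGroup (ι × κ) ℂ := kronecker_mem_unitary (one_mem _) hW
  set T := W'ᴴ * U * V' with hTdef
  have hT : T ∈ Matrix.unitaryGroup (ι × κ) ℂ := mul_mem (mul_mem (Unitary.star_mem hWu) hU) hVu
  have hTT : Tᴴ * T = 1 := mem_unitaryGroup_iff'.1 hT
  have hTT' : T * Tᴴ = 1 := mem_unitaryGroup_iff.1 hT
  have hWW : W'ᴴ * W' = 1 := mem_unitaryGroup_iff'.1 hWu
  have hWW' : W' * W'ᴴ = 1 := mem_unitaryGroup_iff.1 hWu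
  have hin : maxMixedTensor ι ω = (1 / (Fintype.card ι : ℂ)) • (V' * P * V'ᴴ) := by
    rw [maxMixedTensor_eq_smul, hωV, one_kronecker_conj_diagonal]
  have hout : maxMixedTensor ι (environmentMap U ω) =
      (1 / (Fintype.card ι : ℂ)) • (W' * Q * W'ᴴ) := by
    rw [maxMixedTensor_eq_smul, hσW, one_kronecker_conj_diagonal]
  have hrot : W'ᴴ * (U * maxMixedTensor ι ω * Uᴴ) * W' =
      (1 / (Fintype.card ι : ℂ)) • (T * P * Tᴴ) := by
    simp only [hin, hTdef, conjTranspose_mul, conjTranspose_conjTranspose, Matrix.mul_smul,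
      Matrix.smul_mul, Matrix.mul_assoc]
  have hq (l : κ) : q l = ∑ k, transitionWeight T l k * p k := by
    have hWκ : Wᴴ * W = 1 := mem_unitaryGroup_iff'.1 hW
    have hdiag : diagonal (fun k => (q k : ℂ)) = Wᴴ * environmentMap U ω * W := by
      rw [hσW]
      simp only [Matrix.mul_assoc, hWκ, Matrix.mul_one]
      rw [← Matrix.mul_assoc, hWκ, Matrix.one_mul]
    -- The partial trace of the rotated output is `W* L(ω) W`, whose diagonal is `q`.
    have hrot' := congrArg partialTraceFst hrot
    rw [hW', conjTranspose_kronecker, conjTranspose_one, partialTraceFst_mul_one_kronecker,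
      partialTraceFst_one_kronecker_mul, partialTraceFst_smul] at hrot'
    have hll := congrFun (congrFun (hdiag.trans hrot') l) l
    rw [diagonal_apply_eq, Matrix.smul_apply, smul_eq_mul, hP,
      partialTraceFst_conj_diagonal_apply_self] at hll
    exact_mod_cast hll
  obtain ⟨hle, heq⟩ := Real.strictConcaveOn_negMulLog.sum_le_sum_of_doublyStochastic
    transitionWeight_nonneg (sum_transitionWeight_row hT) (sum_transitionWeight_col hT) hp hq
  refine ⟨hle, heq.trans ?_⟩
  -- Entrywise, `T P = Q T` says that `p k - q l` annihilates every entry `T (i, l) (j, k)`.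
  have hcomm : (∀ l k, transitionWeight T l k ≠ 0 → p k = q l) ↔ T * P = Q * T := by
    simp only [transitionWeight_ne_zero_iff, ← Matrix.ext_iff, hP, hQ, mul_diagonal,
      diagonal_mul, Prod.forall]
    constructor
    · intro h i l j k
      by_cases h0 : T (i, l) (j, k) = 0
      · simp [h0]
      · rw [h l k ⟨i, j, h0⟩, mul_comm]
    · rintro h l k ⟨i, j, h0⟩
      have h1 := h i l j k
      rw [mul_comm] at h1
      exact_mod_cast mul_right_cancel₀ h0 h1
  have hN : (1 / (Fintype.card ι : ℂ)) ≠ 0 := by simp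
  rw [hcomm, hout]
  constructor
  · intro h
    have h1 : W'ᴴ * (U * maxMixedTensor ι ω * Uᴴ) * W' = (1 / (Fintype.card ι : ℂ)) • Q := by
      rw [hrot, h, Matrix.mul_assoc, hTT', Matrix.mul_one]
    calc U * maxMixedTensor ι ω * Uᴴ
        = (W' * W'ᴴ) * (U * maxMixedTensor ι ω * Uᴴ) * (W' * W'ᴴ) := by
          rw [hWW', Matrix.one_mul, Matrix.mul_one]
      _ = W' * (W'ᴴ * (U * maxMixedTensor ι ω * Uᴴ) * W') * W'ᴴ := by
          simp only [Matrix.mul_assoc]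
      _ = _ := by rw [h1, Matrix.mul_smul, Matrix.smul_mul]
  · intro h
    rw [h, Matrix.mul_smul, Matrix.smul_mul] at hrot
    have h1 := smul_right_injective _ hN hrot
    calc T * P = T * P * Tᴴ * T := by rw [Matrix.mul_assoc (T * P), hTT, Matrix.mul_one]
      _ = (W'ᴴ * W') * Q * (W'ᴴ * W') * T := by
          rw [← h1]
          simp only [Matrix.mul_assoc]
      _ = Q * T := by rw [hWW, Matrix.one_mul, Matrix.mul_one]
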